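/- Let $d\in\mathbb N$ and write $\hat f(\xi)=\int_{\mathbb R^d}f(x)e^{-2\pi i x\cdot\xi}\,dx$ for the Fourier transform, extended to $L^2(\mathbb R^d)$ by Plancherel; the support $\operatorname{supp} g$ of $g\in L^2(\mathbb R^d)$ is the set of points all of whose neighbourhoods meet $\{g\ne 0\}$ in positive measure. Let $\{\psi_\lambda\}_{\lambda\in\Lambda}\subset L^2(\mathbb R^d)$ be real-valued and band-limited, i.e. $F_\lambda:=\operatorname{supp}\hat\psi_\lambda$ is compact for every $\lambda$, and suppose that they generate a semi-discrete frame: there are constants $B\ge A>0$ with $$A\|g\|_2^2\le\sum_{\lambda\in\Lambda}\|g*\psi_\lambda\|_2^2\le B\|g\|_2^2\qquad\text{for all } g\in L^2(\mathbb R^d).$$ Suppose that the frame has good Fourier-support overlap: there are non-empty open sets $U_\lambda\subseteq F_\lambda$ ($\lambda\in\Lambda$) with $\bigcup_{\lambda}U_\lambda=\mathbb R^d$ such that, whenever $U_\lambda\cap U_\mu\neq\emptyset$, the product $\hat\psi_\lambda\hat\psi_\mu$ does not vanish almost everywhere on $U_\lambda\cap U_\mu$ (this last condition is automatic if the $\hat\psi_\lambda$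 are continuous). For each $\lambda$ let $X_\lambda$ be a sign-blind sampling set for $F_\lambda$, i.e. a lattice $X_\lambda=(M_\lambda^{\top})^{-1}\operatorname{diag}(2s_{\lambda,1},\dots,2s_{\lambda,d})^{-1}\mathbb Z^d$, where $M_\lambda$ is a non-singular real $d\times d$ matrix with $F_\lambda\subseteq M_\lambda[-\tfrac12,\tfrac12]^d$ and $s_{\lambda,1},\dots,s_{\lambda,d}\ge 1$. Let $f\in L^2(\mathbb R^d)$ be real-valued with $\int_{\mathbb R^d}|f(x)|e^{\alpha|x|}\,dx<\infty$ for some $\alpha>0$. If a real-valued $h\in L^2(\mathbb R^d)$ satisfies $|(h*\psi_\lambda)(x)|=|(f*\psi_\lambda)(x)|$ for every $\lambda\in\Lambda$ and every $x\in X_\lambda$, then $h=f$ or $h=-f$ (almost everywhere). -/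

import Mathlib

open MeasureTheory FourierTransform
open scoped ENNReal Topology Matrix

namespace SignRetrieval

noncomputable section

/-- `ℝ^d` with the Euclidean norm. -/
abbrev Rd (d : ℕ) : Type := EuclideanSpace ℝ (Fin d)

/-- `L²(ℝ^d, ℝ)`. -/
abbrev L2R (d : ℕ) : Type := Lp ℝ 2 (volume : Measure (Rd d))

/-- `L²(ℝ^d)`, complex-valued. -/
abbrev L2C (d : ℕ) : Type := Lp ℂ 2 (volume : Measure (Rd d))

/-- The inclusion of `L²(ℝ^d, ℝ)` in `L²(ℝ^d)`. -/
def toComplex {d : ℕ} (f : L2R d) : L2C d := Complex.ofRealCLM.compLp f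

/-- The convolution `(f ∗ g)(x) = ∫ f(t) g(x - t) dt`. For `f, g ∈ L²` the integral converges
absolutely for every `x` and does not depend on the representatives. -/
def conv {d : ℕ} {𝕜 : Type} [RCLike 𝕜] (f g : Lp 𝕜 2 (volume : Measure (Rd d))) : Rd d → 𝕜 :=
  convolution (f : Rd d → 𝕜) (g : Rd d → 𝕜) (ContinuousLinearMap.mul ℝ 𝕜) volume

/-- The `L²` (Plancherel) Fourier transform of a real-valued function, with the normalization
`∫ f(x) exp(-2πi x·ξ) dx`. -/
def fourierL2 {d : ℕ} (f : L2R d) : L2C d := 𝓕 (toComplex f)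

/-- The (closed, essential) support of a function defined up to null sets: the points all of
whose neighbourhoods meet `{g ≠ 0}` in positive measure. -/
def essSupport {d : ℕ} (g : Rd d → ℂ) : Set (Rd d) :=
  {ξ | ∀ V ∈ 𝓝 ξ, volume (V ∩ Function.support g) ≠ 0}

/-- `F_λ = supp ψ̂_λ`. -/
def freqSupport {d : ℕ} (ψ : L2R d) : Set (Rd d) := essSupport (fourierL2 ψ : Rd d → ℂ)

/-- `ψ` is band-limited. -/
def IsBandLimited {d : ℕ} (ψ : L2R d) : Prop := IsCompact (freqSupport ψ)

/-- The translates of the `ψ_λ` form a semi-discrete frame: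
`A ‖f‖₂² ≤ ∑_λ ‖f ∗ ψ_λ‖₂² ≤ B ‖f‖₂²` for all `f ∈ L²(ℝ^d)`, with `B ≥ A > 0`. -/
def IsSemiDiscreteFrame {d : ℕ} {Λ : Type*} (ψ : Λ → L2R d) : Prop :=
  ∃ A B : ℝ, 0 < A ∧ A ≤ B ∧ ∀ f : L2C d,
    ENNReal.ofReal A * eLpNorm f 2 volume ^ 2
        ≤ ∑' l, eLpNorm (conv f (toComplex (ψ l))) 2 volume ^ 2 ∧
      ∑' l, eLpNorm (conv f (toComplex (ψ l))) 2 volume ^ 2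
        ≤ ENNReal.ofReal B * eLpNorm f 2 volume ^ 2

/-- Good Fourier-support overlap: nonempty open `U_λ ⊆ supp ψ̂_λ` cover `ℝ^d`, and where `U_λ` and
`U_μ` meet, `ψ̂_λ` and `ψ̂_μ` are simultaneously nonzero on a part of `U_λ ∩ U_μ` of positive
measure. The last clause follows from the others if the `ψ̂_λ` have continuous representatives;
for arbitrary `ψ_λ ∈ L²` it does not, since the functions `ψ̂_λ`, `ψ̂_μ` may be nonzero exactly on disjoint
sets that are both of positive measure in every ball. -/
def HasGoodFSupportOverlap {d : ℕ} {Λ : Type*} (ψ : Λ → L2R d) : Prop :=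
  ∃ U : Λ → Set (Rd d),
    (∀ l, IsOpen (U l) ∧ (U l).Nonempty ∧ U l ⊆ freqSupport (ψ l)) ∧
    (⋃ l, U l) = Set.univ ∧
    ∀ l m, (U l ∩ U m).Nonempty →
      volume {ξ | ξ ∈ U l ∩ U m ∧ fourierL2 (ψ l) ξ ≠ 0 ∧ fourierL2 (ψ m) ξ ≠ 0} ≠ 0

/-- `M [-1/2, 1/2]^d`. -/
def imageCube {d : ℕ} (M : Matrix (Fin d) (Fin d) ℝ) : Set (Rd d) :=
  {y | ∃ t : Fin d → ℝ, (∀ i, t i ∈ Set.Icc (-(1 / 2) : ℝ) (1 / 2)) ∧ y = WithLp.toLp 2 (M *ᵥ t)}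

/-- The lattice `(Mᵀ)⁻¹ D[2s]⁻¹ ℤ^d`. -/
def samplingLattice {d : ℕ} (M : Matrix (Fin d) (Fin d) ℝ) (s : Fin d → ℝ) : Set (Rd d) :=
  Set.range fun n : Fin d → ℤ =>
    (WithLp.toLp 2 ((Mᵀ)⁻¹ *ᵥ ((Matrix.diagonal fun i => 2 * s i)⁻¹ *ᵥ fun i => (n i : ℝ))) : Rd d)

/-- `X` is a sign-blind sampling set for the compact set `F`. -/
def IsSignBlindSamplingSet {d : ℕ} (F X : Set (Rd d)) : Prop :=
  IsCompact F ∧ ∃ (M : Matrix (Fin d) (Fin d) ℝ) (s : Fin d → ℝ),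
    IsUnit M.det ∧ F ⊆ imageCube M ∧ (∀ i, 1 ≤ s i) ∧ X = samplingLattice M s

end

end SignRetrieval

/-
For `u = h - f` and `v = h + f` the hypothesis says that `(u ∗ ψ_λ)(v ∗ ψ_λ)` vanishes on `X_λ`.
The spectrum of this product lies in a parallelepiped for which `X_λ` is a sampling lattice, so the
product vanishes everywhere. Both factors are real analytic on lines, so one of them is zero: `h`
agrees with `f` or with `-f` after filtering by `ψ_λ`. By Plancherel, a change of sign from `ψ_λ` to
`ψ_μ` would make `f̂` vanish almost everywhere on `{ψ̂_λ ψ̂_μ ≠ 0}`. But for `f ≠ 0` the Fourier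
transform extends holomorphically to a strip, so it vanishes almost nowhere; as the `U_λ` form an
open cover of the connected space `ℝ^d`, the sign is the same for all filters, and the frame
property concludes.
-/

namespace SignRetrieval

section LineAnalytic

open Filter

lemma norm_cexp_mul_ofReal_le (w : ℂ) (r : ℝ) :
    ‖Complex.exp (w * r)‖ ≤ Real.exp (|w.re| * |r|) := by
  rw [Complex.norm_exp, Complex.re_mul_ofReal, ← abs_mul]
  exact Real.exp_le_exp.2 (le_abs_self _)

lemma norm_cexp_mul_ofReal_mul_le {w : ℂ} {c ε : ℝ} (hε : 0 < ε) (hw : |w.re| + ε ≤ c) (r : ℝ) :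
    ‖Complex.exp (w * r) * r‖ ≤ ε⁻¹ * Real.exp (c * |r|) := by
  have hr : |r| ≤ ε⁻¹ * Real.exp (ε * |r|) := by
    rw [inv_mul_eq_div, le_div_iff₀' hε]
    linarith [Real.add_one_le_exp (ε * |r|)]
  calc ‖Complex.exp (w * r) * r‖
      ≤ Real.exp (|w.re| * |r|) * (ε⁻¹ * Real.exp (ε * |r|)) := by
        rw [norm_mul, Complex.norm_real, Real.norm_eq_abs]
        gcongr
        exact norm_cexp_mul_ofReal_le w r
    _ = ε⁻¹ * Real.exp ((|w.re| + ε) * |r|) := by rw [add_mul, Real.exp_add]; ring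
    _ ≤ ε⁻¹ * Real.exp (c * |r|) := by gcongr

section ExponentialIntegral

variable {Ω : Type*} [MeasurableSpace Ω] {μ : Measure Ω} {Γ : Ω → ℂ} {p : Ω → ℝ} {c : ℝ}

lemma differentiableOn_integral_mul_cexp (hΓ : AEStronglyMeasurable Γ μ) (hp : AEMeasurable p μ)
    (hint : Integrable (fun ω => ‖Γ ω‖ * Real.exp (c * |p ω|)) μ) :
    DifferentiableOn ℂ (fun z : ℂ => ∫ ω, Γ ω * Complex.exp (z * p ω) ∂μ) {z | |z.re| < c} := by
  intro z hz
  obtain ⟨ε, hε, hεc⟩ : ∃ ε > 0, |z.re| + 2 * ε ≤ c :=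
    ⟨(c - |z.re|) / 2, half_pos (sub_pos.2 hz), by linarith⟩
  have hp' : AEStronglyMeasurable (fun ω => (p ω : ℂ)) μ :=
    (Complex.measurable_ofReal.comp_aemeasurable hp).aestronglyMeasurable
  have hmeas (w : ℂ) : AEStronglyMeasurable (fun ω => Γ ω * Complex.exp (w * p ω)) μ :=
    hΓ.mul (Complex.continuous_exp.comp_aestronglyMeasurable (hp'.const_mul w))
  have hint_z : Integrable (fun ω => Γ ω * Complex.exp (z * p ω)) μ := by
    refine hint.mono' (hmeas z) (.of_forall fun ω => ?_)
    rw [norm_mul]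
    gcongr
    exact (norm_cexp_mul_ofReal_le z _).trans (Real.exp_le_exp.2 (by gcongr; exact hz.le))
  have hbound : ∀ ω, ∀ w ∈ Metric.ball z ε, ‖Γ ω * (Complex.exp (w * p ω) * p ω)‖
      ≤ ε⁻¹ * (‖Γ ω‖ * Real.exp (c * |p ω|)) := by
    intro ω w hw
    have hre : |w.re| ≤ |z.re| + ε := by
      have := (Complex.abs_re_le_norm (w - z)).trans (mem_ball_iff_norm.1 hw).le
      rw [Complex.sub_re] at this
      linarith [abs_sub_abs_le_abs_sub w.re z.re]
    rw [norm_mul, mul_left_comm]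
    gcongr
    exact norm_cexp_mul_ofReal_mul_le hε (by linarith) _
  refine (hasDerivAt_integral_of_dominated_loc_of_deriv_le (𝕜 := ℂ) (Metric.ball_mem_nhds z hε)
    (.of_forall hmeas) hint_z (by simpa only [mul_assoc, Pi.mul_def] using (hmeas z).mul hp')
    (.of_forall hbound) (hint.const_mul _)
    (.of_forall fun ω w _ => ?_)).2.differentiableAt.differentiableWithinAt
  exact ((hasDerivAt_mul_const (p ω : ℂ)).cexp).const_mul (Γ ω)

lemma analyticOnNhd_integral_mul_cexp_I (hc : 0 < c) (hΓ : AEStronglyMeasurable Γ μ)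
    (hp : AEMeasurable p μ) (hint : Integrable (fun ω => ‖Γ ω‖ * Real.exp (c * |p ω|)) μ) :
    AnalyticOnNhd ℝ (fun t : ℝ => ∫ ω, Γ ω * Complex.exp (Complex.I * t * p ω) ∂μ) Set.univ := by
  have hopen : IsOpen {z : ℂ | |z.re| < c} := isOpen_lt (by fun_prop) continuous_const
  intro t _
  have hI : AnalyticAt ℝ (fun t : ℝ => Complex.I * t) t :=
    analyticAt_const.mul (Complex.ofRealCLM.analyticAt t)
  have hstrip := (differentiableOn_integral_mul_cexp hΓ hp hint).analyticOnNhd hopen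
    (Complex.I * t) (by simpa using hc)
  exact AnalyticAt.fun_comp (f := fun t : ℝ => Complex.I * t)
    (hstrip.restrictScalars (𝕜 := ℝ)) hI

end ExponentialIntegral

section Lines

variable {E : Type*} [AddCommGroup E] [Module ℝ E]

/-- `a` is real analytic along every line. Weaker than joint analyticity, this notion suffices
for the identity theorem and is checked by one-variable complex analysis. -/
def LineAnalytic (a : E → ℂ) : Prop :=
  ∀ x v : E, AnalyticOnNhd ℝ (fun t : ℝ => a (x + t • v)) Set.univ

lemma LineAnalytic.comp_neg {a : E → ℂ} (ha : LineAnalytic a) : LineAnalytic fun x => a (-x) := by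
  intro x v
  simpa only [smul_neg, ← neg_add] using ha (-x) (-v)

lemma LineAnalytic.eq_zero_or_eq_zero_of_mul_eq_zero {a b : E → ℂ} (ha : LineAnalytic a)
    (hb : LineAnalytic b) (hab : ∀ x, a x * b x = 0) : (∀ x, a x = 0) ∨ ∀ x, b x = 0 := by
  refine or_iff_not_imp_left.2 fun hne y => ?_
  obtain ⟨x, hx⟩ := not_forall.1 hne
  have hline : (fun t : ℝ => b (x + t • (y - x))) =ᶠ[𝓝 0] 0 := by
    filter_upwards [(ha x (y - x) 0 (Set.mem_univ _)).continuousAt.eventually_ne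
      (by simpa using hx)] with t ht
    exact (mul_eq_zero.1 (hab _)).resolve_left ht
  simpa using (hb x (y - x)).eqOn_zero_of_preconnected_of_eventuallyEq_zero isPreconnected_univ
    (Set.mem_univ 0) hline (Set.mem_univ 1)

end Lines

section Zeros

variable {E : Type*} [NormedAddCommGroup E] [NormedSpace ℝ E] [FiniteDimensional ℝ E]
  [MeasurableSpace E] [BorelSpace E]

-- Fubini on `ℝ × E` shows that the dilates `t⁻¹ • Z` are null for almost every `t`, and all of
-- them have measure proportional to that of `Z`.
lemma measure_eq_zero_of_forall_line (μ : Measure E) [μ.IsAddHaarMeasure] {Z : Set E}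
    (hZ : MeasurableSet Z) (hline : ∀ x, volume {t : ℝ | t • x ∈ Z} = 0) : μ Z = 0 := by
  have hS : MeasurableSet {q : ℝ × E | q.1 • q.2 ∈ Z} := (measurable_fst.smul measurable_snd) hZ
  have hprod : (volume.prod μ) {q : ℝ × E | q.1 • q.2 ∈ Z} = 0 := by
    rw [Measure.prod_apply_symm hS]
    exact lintegral_eq_zero_of_ae_eq_zero (.of_forall hline)
  obtain ⟨t, ht, ht0⟩ :=
    ((Measure.measure_prod_null hS).1 hprod |>.and (Measure.ae_ne volume (0 : ℝ))).exists
  have hdilate : μ ((t • ·) ⁻¹' Z) = 0 := ht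
  rw [Measure.addHaar_preimage_smul μ ht0] at hdilate
  exact (mul_eq_zero.1 hdilate).resolve_left (by simp [ht0])

lemma LineAnalytic.measure_zeros_eq_zero (μ : Measure E) [μ.IsAddHaarMeasure] {a : E → ℂ}
    (ha : LineAnalytic a) (hm : Measurable a) {x : E} (hx : a x ≠ 0) : μ {y | a y = 0} = 0 := by
  rw [← measure_preimage_add μ x]
  refine measure_eq_zero_of_forall_line μ
    (measurable_const_add x (hm (measurableSet_singleton 0))) fun v => ?_
  have hcodiscrete := (ha x v).preimage_zero_mem_codiscrete (x := 0) (by simpa using hx)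
  have hae := ae_restrict_le_codiscreteWithin (μ := (volume : Measure ℝ)) .univ hcodiscrete
  rw [Measure.restrict_univ, mem_ae_iff] at hae
  exact measure_mono_null (fun t ht => by simpa using ht) hae

end Zeros

section Fourier

variable {E : Type*} [NormedAddCommGroup E] [InnerProductSpace ℝ E] [FiniteDimensional ℝ E]
  [MeasurableSpace E] [BorelSpace E]

lemma lineAnalytic_fourier {Γ : E → ℂ} {c : ℝ} (hc : 0 < c) (hΓ : AEStronglyMeasurable Γ)
    (hint : Integrable fun ξ => ‖Γ ξ‖ * Real.exp (c * ‖ξ‖)) : LineAnalytic (𝓕 Γ) := by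
  intro x v
  set R := 2 * Real.pi * ‖v‖ + 1
  have hRpos : 0 < R := by positivity
  have hphase (ξ : E) : |-(2 * Real.pi * inner ℝ ξ v)| ≤ R * ‖ξ‖ := by
    rw [abs_neg, abs_mul, abs_of_pos Real.two_pi_pos]
    nlinarith [abs_real_inner_le_norm ξ v, Real.two_pi_pos, norm_nonneg ξ]
  have hchar : AEStronglyMeasurable fun ξ : E =>
      Complex.exp ((-(2 * Real.pi * inner ℝ ξ x) : ℝ) * Complex.I) := by fun_prop
  have hexp : Integrable fun ξ : E =>
      ‖Complex.exp ((-(2 * Real.pi * inner ℝ ξ x) : ℝ) * Complex.I) * Γ ξ‖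
        * Real.exp (c / R * |-(2 * Real.pi * inner ℝ ξ v)|) := by
    refine hint.mono' ((hchar.mul hΓ).norm.mul (by fun_prop)) (.of_forall fun ξ => ?_)
    rw [norm_mul, norm_norm, norm_mul, Complex.norm_exp_ofReal_mul_I, one_mul,
      Real.norm_of_nonneg (Real.exp_nonneg _)]
    gcongr ?_ * Real.exp ?_
    calc c / R * |-(2 * Real.pi * inner ℝ ξ v)| ≤ c / R * (R * ‖ξ‖) := by gcongr; exact hphase ξ
      _ = c * ‖ξ‖ := by field_simp
  convert analyticOnNhd_integral_mul_cexp_I (div_pos hc hRpos) (hchar.mul hΓ) (by fun_prop) hexp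
    using 2 with t
  rw [Real.fourier_eq']
  congr with ξ
  rw [smul_eq_mul, Pi.mul_apply, mul_right_comm (Complex.exp _) (Γ ξ), ← Complex.exp_add,
    inner_add_right, inner_smul_right]
  congr 2
  push_cast
  ring

lemma lineAnalytic_fourierInv_of_isCompact {G : E → ℂ} (hG : Integrable G) {F : Set E}
    (hF : IsCompact F) (hsupp : ∀ᵐ ξ, G ξ ≠ 0 → ξ ∈ F) : LineAnalytic (𝓕⁻ G) := by
  obtain ⟨R, hR⟩ := hF.isBounded.exists_norm_le
  have hexp : Integrable fun ξ => ‖G ξ‖ * Real.exp (1 * ‖ξ‖) := by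
    refine (hG.norm.mul_const (Real.exp R)).mono'
      (hG.1.norm.mul (by fun_prop)) ?_
    filter_upwards [hsupp] with ξ hξ
    rcases eq_or_ne (G ξ) 0 with h0 | h0
    · simp [h0]
    · rw [norm_mul, norm_norm, Real.norm_of_nonneg (Real.exp_nonneg _), one_mul]
      gcongr
      exact hR ξ (hξ h0)
  rw [show 𝓕⁻ G = fun x => 𝓕 G (-x) from funext fun x => Real.fourierInv_eq_fourier_neg G x]
  exact (lineAnalytic_fourier one_pos hG.1 hexp).comp_neg

end Fourier

end LineAnalytic

section FourierL2

open scoped SchwartzMap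

variable {E : Type*} [NormedAddCommGroup E] [InnerProductSpace ℝ E] [FiniteDimensional ℝ E]
  [MeasurableSpace E] [BorelSpace E]

lemma ae_eq_of_integral_schwartz_mul_eq {u v : E → ℂ} (hu : LocallyIntegrable u)
    (hv : LocallyIntegrable v) (huv : ∀ φ : 𝓢(E, ℂ), ∫ ξ, φ ξ * u ξ = ∫ ξ, φ ξ * v ξ) :
    u =ᵐ[volume] v := by
  refine ae_eq_of_integral_contDiff_smul_eq hu hv fun g hg hs => ?_
  let φ : 𝓢(E, ℂ) := HasCompactSupport.toSchwartzMap (f := fun x => (g x : ℂ))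
    (hs.comp_left Complex.ofReal_zero) (Complex.ofRealCLM.contDiff.comp hg)
  simpa only [Complex.real_smul] using! huv φ

lemma integral_schwartz_mul_fourier {u : E → ℂ} (hu : Integrable u) (φ : 𝓢(E, ℂ)) :
    ∫ ξ, φ ξ * 𝓕 u ξ = ∫ x, 𝓕 φ x * u x := by
  have hflip := VectorFourier.integral_fourierIntegral_smul_eq_flip (μ := (volume : Measure E))
    (ν := (volume : Measure E)) (L := innerₗ E) (f := u) (g := φ)
    Real.continuous_fourierChar continuous_inner hu φ.integrable
  simp only [smul_eq_mul, flip_innerₗ] at hflip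
  simp only [mul_comm (φ _), SchwartzMap.fourier_coe, mul_comm _ (u _)]
  exact hflip

lemma ae_eq_zero_of_fourierInv_eq_zero {u : E → ℂ} (hu : Integrable u) (hu0 : ∀ x, 𝓕⁻ u x = 0) :
    u =ᵐ[volume] 0 := by
  have hfourier : 𝓕 u = 0 := by
    ext x
    simpa [Real.fourierInv_eq_fourier_neg] using hu0 (-x)
  refine ae_eq_of_integral_schwartz_mul_eq hu.locallyIntegrable
    (integrable_zero _ _ _).locallyIntegrable fun φ => ?_
  have hdual := integral_schwartz_mul_fourier hu (𝓕⁻ φ)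
  rw [hfourier, FourierTransform.fourier_fourierInv_eq] at hdual
  simpa using hdual.symm

lemma continuous_fourier_of_integrable {u : E → ℂ} (hu : Integrable u) : Continuous (𝓕 u) :=
  VectorFourier.fourierIntegral_continuous Real.continuous_fourierChar continuous_inner hu

lemma fourier_ae_eq_of_integrable (f : Lp (α := E) ℂ 2) (hf : Integrable f) :
    (𝓕 f : Lp (α := E) ℂ 2) =ᵐ[volume] 𝓕 (f : E → ℂ) := by
  refine ae_eq_of_integral_schwartz_mul_eq ((Lp.memLp _).locallyIntegrable (by norm_num))
    (continuous_fourier_of_integrable hf).locallyIntegrable fun φ => ?_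
  rw [integral_schwartz_mul_fourier hf]
  have hdistrib := DFunLike.congr_fun (Lp.fourier_toTemperedDistribution_eq f) φ
  simpa [mul_comm] using hdistrib.symm

lemma continuous_fourierInv_mul {Y : Type*} [TopologicalSpace Y] {f g : Y → Lp (α := E) ℂ 2}
    (hf : Continuous f) (hg : Continuous g) (x : E) :
    Continuous fun y => 𝓕⁻ (fun ξ => f y ξ * g y ξ) x := by
  have hχ : MemLp (fun ξ : E => Complex.exp ((2 * Real.pi * inner ℝ ξ x : ℝ) * Complex.I)) ∞ :=
    memLp_top_of_bound (by fun_prop) 1 (.of_forall fun ξ => (Complex.norm_exp_ofReal_mul_I _).le)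
  let prod := (ContinuousLinearMap.mul ℂ ℂ).holderL (volume : Measure E) 2 2 1
  let eval := (ContinuousLinearMap.mul ℂ ℂ).lpPairing (volume : Measure E) ∞ 1 hχ.toLp
  suffices h : ∀ y, 𝓕⁻ (fun ξ => f y ξ * g y ξ) x = eval (prod (f y) (g y)) by
    simp only [h]
    exact eval.continuous.comp ((prod.continuous.comp hf).clm_apply hg)
  intro y
  rw [Real.fourierInv_eq', ContinuousLinearMap.lpPairing_eq_integral]
  refine integral_congr_ae ?_
  filter_upwards [hχ.coeFn_toLp,
    (ContinuousLinearMap.mul ℂ ℂ).coeFn_holder (r := 1) (f y) (g y)] with ξ h₁ h₂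
  rw [h₁]
  exact congrArg _ h₂.symm

variable {d : ℕ} {𝕜 : Type} [RCLike 𝕜]

lemma conv_eq_lpPairing (f g : Lp 𝕜 2 (volume : Measure (Rd d))) (x : Rd d) :
    conv f g x = (ContinuousLinearMap.mul ℝ 𝕜).lpPairing volume 2 2 f
      (Lp.compMeasurePreserving (x - ·) (Measure.measurePreserving_sub_left volume x) g) := by
  rw [ContinuousLinearMap.lpPairing_eq_integral, conv, convolution]
  refine integral_congr_ae ?_
  filter_upwards [Lp.coeFn_compMeasurePreserving g (Measure.measurePreserving_sub_left volume x)]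
    with t ht
  rw [ht, Function.comp_apply]

lemma conv_add_left (f f' g : Lp 𝕜 2 (volume : Measure (Rd d))) :
    conv (f + f') g = conv f g + conv f' g := by
  ext x
  simp only [Pi.add_apply, conv_eq_lpPairing, map_add, add_apply]

lemma conv_sub_left (f f' g : Lp 𝕜 2 (volume : Measure (Rd d))) :
    conv (f - f') g = conv f g - conv f' g := by
  ext x
  simp only [Pi.sub_apply, conv_eq_lpPairing, map_sub, sub_apply]

lemma continuous_conv {Y : Type*} [TopologicalSpace Y]
    {f g : Y → Lp 𝕜 2 (volume : Measure (Rd d))} (hf : Continuous f) (hg : Continuous g)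
    (x : Rd d) : Continuous fun y => conv (f y) (g y) x := by
  simp only [conv_eq_lpPairing]
  exact (((ContinuousLinearMap.mul ℝ 𝕜).lpPairing volume 2 2).continuous.comp hf).clm_apply
    ((Lp.isometry_compMeasurePreserving _).continuous.comp hg)

lemma conv_toLp (φ γ : 𝓢(Rd d, ℂ)) :
    conv (φ.toLp 2) (γ.toLp 2) = SchwartzMap.convolution (ContinuousLinearMap.mul ℂ ℂ) φ γ := by
  ext x
  rw [SchwartzMap.convolution_apply, conv, convolution, convolution]
  refine integral_congr_ae ?_
  have hreflect := (Measure.measurePreserving_sub_left (volume : Measure (Rd d))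
    x).quasiMeasurePreserving.ae_eq_comp (γ.coeFn_toLp 2 volume)
  filter_upwards [φ.coeFn_toLp 2, hreflect] with t hφ hγ
  simp only [Function.comp_apply] at hγ
  simp [hφ, hγ]

lemma conv_toLp_eq_fourierInv (φ γ : 𝓢(Rd d, ℂ)) (x : Rd d) :
    conv (φ.toLp 2) (γ.toLp 2) x
      = 𝓕⁻ (fun ξ => (𝓕 (φ.toLp 2) : L2C d) ξ * (𝓕 (γ.toLp 2) : L2C d) ξ) x := by
  have hinv : SchwartzMap.convolution (ContinuousLinearMap.mul ℂ ℂ) φ γ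
      = 𝓕⁻ (𝓕 (SchwartzMap.convolution (ContinuousLinearMap.mul ℂ ℂ) φ γ)) := by simp
  rw [conv_toLp, hinv, SchwartzMap.fourier_convolution, SchwartzMap.fourierInv_coe,
    Real.fourierInv_eq', Real.fourierInv_eq', SchwartzMap.toLp_fourier_eq,
    SchwartzMap.toLp_fourier_eq]
  refine integral_congr_ae ?_
  filter_upwards [(𝓕 φ).coeFn_toLp 2, (𝓕 γ).coeFn_toLp 2] with ξ hφ hγ
  rw [hφ, hγ]
  simp

theorem conv_eq_fourierInv (f g : L2C d) (x : Rd d) :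
    conv f g x = 𝓕⁻ (fun ξ => (𝓕 f : L2C d) ξ * (𝓕 g : L2C d) ξ) x := by
  have hdense : DenseRange fun φ : 𝓢(Rd d, ℂ) => (φ.toLp 2 : L2C d) :=
    SchwartzMap.denseRange_toLpCLM (F := ℂ) (p := 2) (μ := (volume : Measure (Rd d)))
      ENNReal.ofNat_ne_top
  have hclosed : IsClosed {q : L2C d × L2C d |
      conv q.1 q.2 x = 𝓕⁻ (fun ξ => (𝓕 q.1 : L2C d) ξ * (𝓕 q.2 : L2C d) ξ) x} :=
    isClosed_eq (continuous_conv continuous_fst continuous_snd x) (continuous_fourierInv_mul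
      (continuous_fourier.comp continuous_fst) (continuous_fourier.comp continuous_snd) x)
  exact hdense.induction_on₂ hclosed (fun φ γ => conv_toLp_eq_fourierInv φ γ x) f g

end FourierL2

section Sampling

open Filter

variable {Ω : Type*} [MeasurableSpace Ω] {μ : Measure Ω} {Γ : Ω → ℂ}

lemma integrable_mul_continuousMap_comp {Y : Type*} [TopologicalSpace Y] [CompactSpace Y]
    [MeasurableSpace Y] [OpensMeasurableSpace Y] (hΓ : Integrable Γ μ) {q : Ω → Y}
    (hq : Measurable q) (φ : C(Y, ℂ)) : Integrable (fun ω => Γ ω * φ (q ω)) μ :=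
  hΓ.mul_bdd (c := ‖φ‖) (φ.continuous.measurable.comp hq).aestronglyMeasurable
    (.of_forall fun _ => φ.norm_coe_le_norm _)

lemma integral_mul_comp_eq_zero_of_span_dense {Y : Type*} [TopologicalSpace Y] [CompactSpace Y]
    [MeasurableSpace Y] [OpensMeasurableSpace Y] {S : Set C(Y, ℂ)}
    (hS : (Submodule.span ℂ S).topologicalClosure = ⊤) (hΓ : Integrable Γ μ) {q : Ω → Y}
    (hq : Measurable q) (hΓS : ∀ φ ∈ S, ∫ ω, Γ ω * φ (q ω) ∂μ = 0) (φ : C(Y, ℂ)) :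
    ∫ ω, Γ ω * φ (q ω) ∂μ = 0 := by
  have hint (φ : C(Y, ℂ)) := integrable_mul_continuousMap_comp hΓ hq φ
  let T : C(Y, ℂ) →L[ℂ] ℂ := LinearMap.mkContinuous
    { toFun := fun φ => ∫ ω, Γ ω * φ (q ω) ∂μ
      map_add' := fun φ φ' => by
        simp only [ContinuousMap.add_apply, mul_add, integral_add (hint φ) (hint φ')]
      map_smul' := fun a φ => by
        simp only [ContinuousMap.smul_apply, smul_eq_mul, mul_left_comm, integral_const_mul,
          RingHom.id_apply] }
    (∫ ω, ‖Γ ω‖ ∂μ) (fun φ => by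
      rw [← integral_mul_const]
      refine norm_integral_le_of_norm_le (hΓ.norm.mul_const _) (.of_forall fun ω => ?_)
      rw [norm_mul]
      gcongr
      exact φ.norm_coe_le_norm _)
  have hker : (Submodule.span ℂ S).topologicalClosure ≤ T.ker :=
    Submodule.topologicalClosure_minimal _ (Submodule.span_le.2 hΓS) T.isClosed_ker
  rw [hS] at hker
  exact hker (Submodule.mem_top (x := φ))

/-- A continuous function on `ℝ` supported in `[-1/2, 1/2]`; as `k → ∞` these cutoffs increase to
the indicator function of the open interval. -/
noncomputable def cutoff (k : ℕ) (t : ℝ) : ℝ := min 1 (k * max 0 (1 / 2 - |t|))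

lemma abs_cutoff_le_one (k : ℕ) (t : ℝ) : |cutoff k t| ≤ 1 := by
  rw [abs_of_nonneg (by unfold cutoff; positivity)]
  exact min_le_left _ _

lemma continuous_cutoff (k : ℕ) : Continuous (cutoff k) := by
  unfold cutoff
  fun_prop

lemma cutoff_eq_zero (k : ℕ) {t : ℝ} (ht : 1 / 2 ≤ |t|) : cutoff k t = 0 := by
  rw [cutoff, max_eq_left (sub_nonpos.2 ht), mul_zero, min_eq_right zero_le_one]

lemma tendsto_cutoff {t : ℝ} (ht : |t| < 1 / 2) :
    Tendsto (fun k => cutoff k t) atTop (𝓝 1) := by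
  obtain ⟨N, hN⟩ := exists_nat_ge (1 / (1 / 2 - |t|))
  refine tendsto_const_nhds.congr' ?_
  filter_upwards [eventually_ge_atTop N] with k hk
  have hpos : 0 < 1 / 2 - |t| := sub_pos.2 ht
  rw [cutoff, max_eq_right hpos.le, min_eq_left]
  exact (div_le_iff₀ hpos).1 (hN.trans (Nat.cast_le.2 hk))

-- A continuous function on `ℝ`, restricted to `(-1/2, 1/2)`, need not extend to the circle
-- continuously, so it is only a pointwise limit there.
lemma exists_tendsto_unitAddCircle {g : ℝ → ℂ} (hg : Continuous g) {C : ℝ} (hC : ∀ t, ‖g t‖ ≤ C) :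
    ∃ φ : ℕ → C(UnitAddCircle, ℂ), ∀ t : ℝ, |t| < 1 / 2 →
      (∀ k, ‖φ k t‖ ≤ C) ∧ Tendsto (fun k => φ k t) atTop (𝓝 (g t)) := by
  let G (k : ℕ) (t : ℝ) : ℂ := cutoff k t * g t
  have hG (k : ℕ) : Continuous (AddCircle.liftIco 1 (-(1 / 2)) (G k)) := by
    refine AddCircle.liftIco_continuous ?_ (Continuous.continuousOn ?_)
    · simp only [G, cutoff_eq_zero k (t := -(1 / 2)) (by norm_num),
        cutoff_eq_zero k (t := -(1 / 2) + 1) (by norm_num), Complex.ofReal_zero, zero_mul]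
    · exact (Complex.continuous_ofReal.comp (continuous_cutoff k)).mul hg
  refine ⟨fun k => ⟨_, hG k⟩, fun t ht => ?_⟩
  have hval (k : ℕ) : AddCircle.liftIco 1 (-(1 / 2)) (G k) (t : UnitAddCircle) = G k t :=
    AddCircle.liftIco_coe_apply ⟨(abs_lt.1 ht).1.le, by linarith [(abs_lt.1 ht).2]⟩
  simp only [ContinuousMap.coe_mk, hval]
  constructor
  · intro k
    rw [norm_mul, Complex.norm_real, Real.norm_eq_abs]
    exact (mul_le_of_le_one_left (norm_nonneg _) (abs_cutoff_le_one k t)).trans (hC t)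
  · simpa using ((Complex.continuous_ofReal.tendsto 1).comp (tendsto_cutoff ht)).mul_const (g t)

variable {ι : Type*} [Fintype ι] {p : Ω → ι → ℝ}

lemma cexp_two_pi_dotProduct (z w : ι → ℝ) :
    Complex.exp ((2 * Real.pi * (z ⬝ᵥ w) : ℝ) * Complex.I)
      = ∏ i, Complex.exp ((2 * Real.pi * (z i * w i) : ℝ) * Complex.I) := by
  rw [← Complex.exp_sum, ← Finset.sum_mul, ← Complex.ofReal_sum, dotProduct, Finset.mul_sum]

lemma mFourier_coe (n : ι → ℤ) (w : ι → ℝ) :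
    UnitAddTorus.mFourier n (fun i => (w i : UnitAddCircle))
      = Complex.exp ((2 * Real.pi * ((fun i => (n i : ℝ)) ⬝ᵥ w) : ℝ) * Complex.I) := by
  rw [cexp_two_pi_dotProduct, UnitAddTorus.mFourier, ContinuousMap.coe_mk]
  refine Finset.prod_congr rfl fun i _ => ?_
  rw [fourier_coe_apply]
  congr 1
  push_cast
  ring

theorem integral_mul_cexp_eq_zero_of_int (hΓ : Integrable Γ μ) (hp : Measurable p)
    (hcube : ∀ᵐ ω ∂μ, Γ ω ≠ 0 → ∀ i, |p ω i| < 1 / 2)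
    (hint : ∀ n : ι → ℤ, ∫ ω, Γ ω *
      Complex.exp ((2 * Real.pi * ((fun i => (n i : ℝ)) ⬝ᵥ p ω) : ℝ) * Complex.I) ∂μ = 0)
    (y : ι → ℝ) :
    ∫ ω, Γ ω * Complex.exp ((2 * Real.pi * (y ⬝ᵥ p ω) : ℝ) * Complex.I) ∂μ = 0 := by
  let q (ω : Ω) : UnitAddTorus ι := fun i => (p ω i : UnitAddCircle)
  have hq : Measurable q := measurable_pi_lambda _ fun i =>
    AddCircle.measurable_mk'.comp ((measurable_pi_apply i).comp hp)
  have htorus : ∀ Φ : C(UnitAddTorus ι, ℂ), ∫ ω, Γ ω * Φ (q ω) ∂μ = 0 := by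
    refine integral_mul_comp_eq_zero_of_span_dense UnitAddTorus.span_mFourier_closure_eq_top
      hΓ hq ?_
    rintro _ ⟨n, rfl⟩
    simpa only [q, mFourier_coe] using hint n
  choose φ hφ using fun i => exists_tendsto_unitAddCircle
    (g := fun t : ℝ => Complex.exp ((2 * Real.pi * (y i * t) : ℝ) * Complex.I)) (by fun_prop)
    fun t => (Complex.norm_exp_ofReal_mul_I _).le
  let Φ (k : ℕ) : C(UnitAddTorus ι, ℂ) := ⟨fun θ => ∏ i, φ i k (θ i), by fun_prop⟩
  have hbound (k : ℕ) : ∀ᵐ ω ∂μ, ‖Γ ω * Φ k (q ω)‖ ≤ ‖Γ ω‖ := by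
    filter_upwards [hcube] with ω hω
    rcases eq_or_ne (Γ ω) 0 with h0 | h0
    · simp [h0]
    · rw [norm_mul]
      refine mul_le_of_le_one_right (norm_nonneg _) ((norm_prod _ _).trans_le ?_)
      exact Finset.prod_le_one (fun _ _ => norm_nonneg _) fun i _ => (hφ i _ (hω h0 i)).1 k
  have hlim : ∀ᵐ ω ∂μ, Tendsto (fun k => Γ ω * Φ k (q ω)) atTop
      (𝓝 (Γ ω * Complex.exp ((2 * Real.pi * (y ⬝ᵥ p ω) : ℝ) * Complex.I))) := by
    filter_upwards [hcube] with ω hω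
    rcases eq_or_ne (Γ ω) 0 with h0 | h0
    · simp [h0]
    · rw [cexp_two_pi_dotProduct]
      exact (tendsto_finsetProd _ fun i _ => (hφ i _ (hω h0 i)).2).const_mul _
  refine tendsto_nhds_unique (tendsto_integral_of_dominated_convergence _
    (fun k => (integrable_mul_continuousMap_comp hΓ hq (Φ k)).1) hΓ.norm hbound hlim) ?_
  simp only [htorus, tendsto_const_nhds]

end Sampling

section Lattice

variable {ι : Type*} [Fintype ι]

lemma fourierInv_mul_fourierInv (K L : EuclideanSpace ℝ ι → ℂ) (x : EuclideanSpace ℝ ι) :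
    𝓕⁻ K x * 𝓕⁻ L x = ∫ q : EuclideanSpace ℝ ι × EuclideanSpace ℝ ι, K q.1 * L q.2 *
      Complex.exp ((2 * Real.pi * inner ℝ (q.1 + q.2) x : ℝ) * Complex.I) := by
  rw [Real.fourierInv_eq', Real.fourierInv_eq', ← integral_prod_mul, Measure.volume_eq_prod]
  refine integral_congr_ae (.of_forall fun q => ?_)
  simp only [smul_eq_mul, inner_add_left, mul_add, Complex.ofReal_add, add_mul, Complex.exp_add]
  ring

variable [DecidableEq ι] {B : Matrix ι ι ℝ}

/-- The point with coordinate vector `y` in the basis dual to the columns of `B`. For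
`B = M D[2s]` and `y ∈ ℤ^d` these are the points of `samplingLattice M s`. -/
noncomputable def dualPoint (B : Matrix ι ι ℝ) (y : ι → ℝ) : EuclideanSpace ℝ ι :=
  WithLp.toLp 2 ((Bᵀ)⁻¹ *ᵥ y)

lemma inner_dualPoint (ξ : EuclideanSpace ℝ ι) (y : ι → ℝ) :
    inner ℝ ξ (dualPoint B y) = y ⬝ᵥ (B⁻¹ *ᵥ ξ.ofLp) := by
  rw [dualPoint, EuclideanSpace.inner_eq_star_dotProduct, star_trivial,
    ← Matrix.transpose_nonsing_inv, Matrix.mulVec_transpose, Matrix.dotProduct_mulVec]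

lemma dualPoint_surjective (hB : IsUnit B.det) : Function.Surjective (dualPoint B) := fun x =>
  ⟨Bᵀ *ᵥ x.ofLp, by
    rw [dualPoint, Matrix.mulVec_mulVec, Matrix.nonsing_inv_mul _ (B.isUnit_det_transpose hB),
      Matrix.one_mulVec]⟩

-- The product of the two functions has its spectrum in the sum of the two parallelepipeds, twice
-- as large as either of them: hence `1/4`, half the Nyquist rate `1/2`.
theorem fourierInv_mul_eq_zero_of_dualPoint (hB : IsUnit B.det) {K L : EuclideanSpace ℝ ι → ℂ}
    (hK : Integrable K) (hL : Integrable L)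
    (hKB : ∀ᵐ ξ, K ξ ≠ 0 → ∀ i, |(B⁻¹ *ᵥ ξ.ofLp) i| < 1 / 4)
    (hLB : ∀ᵐ ξ, L ξ ≠ 0 → ∀ i, |(B⁻¹ *ᵥ ξ.ofLp) i| < 1 / 4)
    (hKL : ∀ n : ι → ℤ, 𝓕⁻ K (dualPoint B fun i => n i) * 𝓕⁻ L (dualPoint B fun i => n i) = 0)
    (x : EuclideanSpace ℝ ι) : 𝓕⁻ K x * 𝓕⁻ L x = 0 := by
  simp only [fourierInv_mul_fourierInv, inner_dualPoint] at hKL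
  obtain ⟨y, rfl⟩ := dualPoint_surjective hB x
  simp only [fourierInv_mul_fourierInv, inner_dualPoint]
  refine integral_mul_cexp_eq_zero_of_int (hK.mul_prod hL) ?_ ?_ hKL y
  · refine measurable_pi_lambda _ fun i => ?_
    simp only [Matrix.mulVec, dotProduct]
    fun_prop
  · filter_upwards [Measure.quasiMeasurePreserving_fst.ae hKB,
      Measure.quasiMeasurePreserving_snd.ae hLB] with q hq₁ hq₂ hq i
    rw [WithLp.ofLp_add, Matrix.mulVec_add, Pi.add_apply]
    have h₁ := hq₁ (left_ne_zero_of_mul hq) i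
    have h₂ := hq₂ (right_ne_zero_of_mul hq) i
    exact (abs_add_le _ _).trans_lt (by linarith)

lemma ae_mulVec_apply_ne {A : Matrix ι ι ℝ} (hA : IsUnit A.det) (i : ι) (c : ℝ) :
    ∀ᵐ ξ : EuclideanSpace ℝ ι, (A *ᵥ ξ.ofLp) i ≠ c := by
  have hdet : (Matrix.toLin' A).det ≠ 0 := by
    rw [LinearMap.det_toLin']
    exact hA.ne_zero
  have hquasi := (Measure.LinearMap.quasiMeasurePreserving volume _ hdet).comp
    (PiLp.volume_preserving_ofLp ι).quasiMeasurePreserving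
  exact hquasi.ae (Measure.ae_eval_ne (μ := fun _ => volume) i c)

end Lattice

section SamplingLattice

variable {d : ℕ} {M : Matrix (Fin d) (Fin d) ℝ} {s : Fin d → ℝ}

lemma isUnit_det_mul_diagonal_two_mul (hM : IsUnit M.det) (hs : ∀ i, s i ≠ 0) :
    IsUnit (M * Matrix.diagonal fun i => 2 * s i).det := by
  rw [Matrix.det_mul, Matrix.det_diagonal]
  exact hM.mul (isUnit_iff_ne_zero.2
    (Finset.prod_ne_zero_iff.2 fun i _ => mul_ne_zero two_ne_zero (hs i)))

lemma dualPoint_mem_samplingLattice (n : Fin d → ℤ) :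
    dualPoint (M * Matrix.diagonal fun i => 2 * s i) (fun i => n i) ∈ samplingLattice M s :=
  ⟨n, by
    rw [dualPoint, Matrix.transpose_mul, Matrix.diagonal_transpose, Matrix.mul_inv_rev,
      ← Matrix.mulVec_mulVec]⟩

lemma ae_abs_lt_of_mem_imageCube (hM : IsUnit M.det) (hs : ∀ i, 1 ≤ s i) :
    ∀ᵐ ξ : Rd d, ξ ∈ imageCube M →
      ∀ i, |((M * Matrix.diagonal fun i => 2 * s i)⁻¹ *ᵥ ξ.ofLp) i| < 1 / 4 := by
  have hs₀ (i : Fin d) : 0 < s i := one_pos.trans_le (hs i)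
  have hB := isUnit_det_mul_diagonal_two_mul hM fun i => (hs₀ i).ne'
  have hB' := Matrix.isUnit_nonsing_inv_det _ hB
  filter_upwards [ae_all_iff.2 fun i => ae_mulVec_apply_ne hB' i (1 / 4),
    ae_all_iff.2 fun i => ae_mulVec_apply_ne hB' i (-(1 / 4))] with ξ hξ hξ' hcube i
  obtain ⟨t, ht, rfl⟩ := hcube
  have hcoord : (M * Matrix.diagonal fun i => 2 * s i)⁻¹ *ᵥ (M *ᵥ t) =
      fun i => t i / (2 * s i) := by
    have ht' : M *ᵥ t = (M * Matrix.diagonal fun i => 2 * s i) *ᵥ fun i => t i / (2 * s i) := by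
      rw [← Matrix.mulVec_mulVec]
      congr 1
      ext i
      rw [Matrix.mulVec_diagonal, mul_div_cancel₀ _ (by linarith [hs₀ i])]
    rw [ht', Matrix.mulVec_mulVec, Matrix.nonsing_inv_mul _ hB, Matrix.one_mulVec]
  have hle : |t i / (2 * s i)| ≤ 1 / 4 := by
    rw [abs_div, abs_of_pos (mul_pos two_pos (hs₀ i)), div_le_iff₀ (mul_pos two_pos (hs₀ i))]
    linarith [abs_le.2 (ht i), hs i]
  simp only [hcoord] at hξ hξ' ⊢
  exact lt_of_le_of_ne hle fun h => (eq_or_eq_neg_of_abs_eq h).elim (hξ i) (hξ' i)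

end SamplingLattice

section RealFilters

variable {d : ℕ}

lemma coeFn_toComplex (f : L2R d) : toComplex f =ᵐ[volume] fun x => (f x : ℂ) :=
  Complex.ofRealCLM.coeFn_compLp f

lemma toComplex_sub (f g : L2R d) : toComplex (f - g) = toComplex f - toComplex g :=
  map_sub (Complex.ofRealCLM.compLpL 2 (volume : Measure (Rd d))) f g

lemma toComplex_add (f g : L2R d) : toComplex (f + g) = toComplex f + toComplex g :=
  map_add (Complex.ofRealCLM.compLpL 2 (volume : Measure (Rd d))) f g

lemma toComplex_eq_zero {f : L2R d} (hf : toComplex f = 0) : f = 0 := by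
  rw [Lp.eq_zero_iff_ae_eq_zero] at hf ⊢
  filter_upwards [hf, coeFn_toComplex f] with x hx hx'
  exact Complex.ofReal_eq_zero.1 (hx'.symm.trans hx)

lemma conv_toComplex (f g : L2R d) (x : Rd d) :
    conv (toComplex f) (toComplex g) x = ((conv f g x : ℝ) : ℂ) := by
  rw [conv, conv, convolution, convolution, ← integral_complex_ofReal]
  have hg := (Measure.measurePreserving_sub_left (volume : Measure (Rd d))
    x).quasiMeasurePreserving.ae (coeFn_toComplex g)
  refine integral_congr_ae ?_
  filter_upwards [coeFn_toComplex f, hg] with t hf hg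
  simp only [hf, hg, ContinuousLinearMap.mul_apply', Complex.ofReal_mul]

lemma fourierL2_sub (f g : L2R d) : fourierL2 (f - g) = fourierL2 f - fourierL2 g := by
  rw [fourierL2, toComplex_sub]
  exact map_sub (Lp.fourierTransformₗᵢ (Rd d) ℂ) _ _

lemma fourierL2_add (f g : L2R d) : fourierL2 (f + g) = fourierL2 f + fourierL2 g := by
  rw [fourierL2, toComplex_add]
  exact map_add (Lp.fourierTransformₗᵢ (Rd d) ℂ) _ _

lemma fourierL2_eq_zero {f : L2R d} (hf : fourierL2 f = 0) : f = 0 :=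
  toComplex_eq_zero ((map_eq_zero_iff (Lp.fourierTransformₗᵢ (Rd d) ℂ)
    (Lp.fourierTransformₗᵢ (Rd d) ℂ).injective).1 hf)

lemma integrable_fourierL2_mul (f ψ : L2R d) :
    Integrable fun ξ => fourierL2 f ξ * fourierL2 ψ ξ :=
  (Lp.memLp _).integrable_mul (Lp.memLp _)

lemma ofReal_conv_eq_fourierInv (f ψ : L2R d) (x : Rd d) :
    ((conv f ψ x : ℝ) : ℂ) = 𝓕⁻ (fun ξ => fourierL2 f ξ * fourierL2 ψ ξ) x :=
  (conv_toComplex f ψ x).symm.trans (conv_eq_fourierInv _ _ x)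

lemma fourierL2_mul_ae_eq_zero {f ψ : L2R d} (hf : conv f ψ = 0) :
    ∀ᵐ ξ, fourierL2 f ξ * fourierL2 ψ ξ = 0 :=
  ae_eq_zero_of_fourierInv_eq_zero (integrable_fourierL2_mul f ψ) fun x => by
    rw [← ofReal_conv_eq_fourierInv, hf, Pi.zero_apply, Complex.ofReal_zero]

lemma ae_mem_essSupport (g : Rd d → ℂ) : ∀ᵐ ξ, g ξ ≠ 0 → ξ ∈ essSupport g := by
  have hnull : volume (Function.support g \ essSupport g) = 0 := by
    refine measure_null_of_locally_null _ fun ξ hξ => ?_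
    have hξ' := hξ.2
    simp only [essSupport, Set.mem_ofPred_eq, not_forall, not_not] at hξ'
    obtain ⟨V, hV, hV₀⟩ := hξ'
    exact ⟨V ∩ Function.support g, Filter.inter_mem (mem_nhdsWithin_of_mem_nhds hV)
      (Filter.mem_of_superset self_mem_nhdsWithin Set.sdiff_subset), hV₀⟩
  filter_upwards [measure_eq_zero_iff_ae_notMem.1 hnull] with ξ hξ hg
  exact not_not.1 fun hξ' => hξ ⟨hg, hξ'⟩

lemma ae_mem_freqSupport (f ψ : L2R d) :
    ∀ᵐ ξ, fourierL2 f ξ * fourierL2 ψ ξ ≠ 0 → ξ ∈ freqSupport ψ :=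
  (ae_mem_essSupport (fourierL2 ψ)).mono fun _ hξ hne => hξ (right_ne_zero_of_mul hne)

lemma lineAnalytic_conv {ψ : L2R d} (hψ : IsBandLimited ψ) (f : L2R d) :
    LineAnalytic fun x => ((conv f ψ x : ℝ) : ℂ) := by
  simp only [ofReal_conv_eq_fourierInv]
  exact lineAnalytic_fourierInv_of_isCompact (integrable_fourierL2_mul f ψ) hψ
    (ae_mem_freqSupport f ψ)

theorem conv_eq_zero_or_conv_eq_zero {ψ u v : L2R d} {X : Set (Rd d)}
    (hX : IsSignBlindSamplingSet (freqSupport ψ) X)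
    (huv : ∀ x ∈ X, conv u ψ x * conv v ψ x = 0) : conv u ψ = 0 ∨ conv v ψ = 0 := by
  obtain ⟨hψ, M, s, hM, hcube, hs, rfl⟩ := hX
  have hquarter (g : L2R d) : ∀ᵐ ξ, fourierL2 g ξ * fourierL2 ψ ξ ≠ 0 →
      ∀ i, |((M * Matrix.diagonal fun i => 2 * s i)⁻¹ *ᵥ ξ.ofLp) i| < 1 / 4 := by
    filter_upwards [ae_mem_freqSupport g ψ, ae_abs_lt_of_mem_imageCube hM hs] with ξ hξ hlt hne
    exact hlt (hcube (hξ hne))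
  have hmul (x : Rd d) : ((conv u ψ x : ℝ) : ℂ) * (conv v ψ x : ℝ) = 0 := by
    rw [ofReal_conv_eq_fourierInv, ofReal_conv_eq_fourierInv]
    refine fourierInv_mul_eq_zero_of_dualPoint
      (isUnit_det_mul_diagonal_two_mul hM fun i => (one_pos.trans_le (hs i)).ne')
      (integrable_fourierL2_mul u ψ) (integrable_fourierL2_mul v ψ) (hquarter u) (hquarter v)
      (fun n => ?_) x
    rw [← ofReal_conv_eq_fourierInv, ← ofReal_conv_eq_fourierInv]
    exact_mod_cast huv _ (dualPoint_mem_samplingLattice n)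
  simp only [funext_iff, Pi.zero_apply]
  exact_mod_cast
    (lineAnalytic_conv hψ u).eq_zero_or_eq_zero_of_mul_eq_zero (lineAnalytic_conv hψ v) hmul

theorem fourierL2_ae_ne_zero {f : L2R d} (hf : ∃ α : ℝ, 0 < α ∧
    Integrable (fun x : Rd d => |f x| * Real.exp (α * ‖x‖)) volume) (hf₀ : f ≠ 0) :
    ∀ᵐ ξ, fourierL2 f ξ ≠ 0 := by
  obtain ⟨α, hα, hint⟩ := hf
  have hm : AEStronglyMeasurable (toComplex f) volume := Lp.aestronglyMeasurable _
  have hint' : Integrable fun x : Rd d => ‖toComplex f x‖ * Real.exp (α * ‖x‖) := by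
    refine hint.congr ?_
    filter_upwards [coeFn_toComplex f] with x hx
    rw [hx, Complex.norm_real, Real.norm_eq_abs]
  have hL1 : Integrable (toComplex f) := hint'.mono' hm (.of_forall fun x =>
    le_mul_of_one_le_right (norm_nonneg _) (Real.one_le_exp (by positivity)))
  have hae : fourierL2 f =ᵐ[volume] 𝓕 (toComplex f : Rd d → ℂ) :=
    fourier_ae_eq_of_integrable (toComplex f) hL1
  obtain ⟨ξ₀, hξ₀⟩ : ∃ ξ, 𝓕 (toComplex f : Rd d → ℂ) ξ ≠ 0 := by
    by_contra! hzero
    refine hf₀ (fourierL2_eq_zero (Lp.eq_zero_iff_ae_eq_zero.2 ?_))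
    exact hae.trans (.of_forall hzero)
  have hnull := (lineAnalytic_fourier hα hm hint').measure_zeros_eq_zero volume
    (continuous_fourier_of_integrable hL1).measurable hξ₀
  filter_upwards [hae, measure_eq_zero_iff_ae_notMem.1 hnull] with ξ hξ hne
  rwa [hξ]

end RealFilters

section Frames

variable {d : ℕ}

lemma IsSemiDiscreteFrame.eq_zero {Λ : Type*} {ψ : Λ → L2R d} (hψ : IsSemiDiscreteFrame ψ)
    (g : L2R d) (hg : ∀ l, conv g (ψ l) = 0) : g = 0 := by
  obtain ⟨A, B, hA, -, hAB⟩ := hψ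
  have hconv (l : Λ) : conv (toComplex g) (toComplex (ψ l)) = 0 := funext fun x => by
    rw [conv_toComplex, hg, Pi.zero_apply, Complex.ofReal_zero, Pi.zero_apply]
  have hle := (hAB (toComplex g)).1
  simp only [hconv, eLpNorm_zero, ne_eq, OfNat.ofNat_ne_zero, not_false_eq_true, zero_pow,
    tsum_zero, nonpos_iff_eq_zero, mul_eq_zero, pow_eq_zero_iff, ENNReal.ofReal_eq_zero,
    hA.not_ge, false_or] at hle
  refine toComplex_eq_zero (Lp.eq_zero_iff_ae_eq_zero.2 ?_)
  exact (eLpNorm_eq_zero_iff (Lp.aestronglyMeasurable _) two_ne_zero).1 hle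

/-- Two filters overlap if their Fourier transforms are simultaneously nonzero on a set of positive
measure. A chain of overlapping filters carries the sign found at one filter to all the others. -/
def FrequenciesOverlap (ψ φ : L2R d) : Prop := ∃ᵐ ξ, fourierL2 ψ ξ ≠ 0 ∧ fourierL2 φ ξ ≠ 0

lemma FrequenciesOverlap.conv_add_ne_zero {ψ φ f h : L2R d} (hψφ : FrequenciesOverlap ψ φ)
    (hf : ∀ᵐ ξ, fourierL2 f ξ ≠ 0) (hsub : conv (h - f) ψ = 0) : conv (h + f) φ ≠ 0 := by
  intro hadd
  refine hψφ ?_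
  have hsub' := Lp.coeFn_sub (fourierL2 h) (fourierL2 f)
  have hadd' := Lp.coeFn_add (fourierL2 h) (fourierL2 f)
  rw [← fourierL2_sub] at hsub'
  rw [← fourierL2_add] at hadd'
  filter_upwards [hf, hsub', hadd', fourierL2_mul_ae_eq_zero hsub, fourierL2_mul_ae_eq_zero hadd]
    with ξ hfξ hsubξ haddξ hψξ hφξ hne
  have hminus : fourierL2 h ξ - fourierL2 f ξ = 0 :=
    hsubξ.symm.trans ((mul_eq_zero.1 hψξ).resolve_right hne.1)
  have hplus : fourierL2 h ξ + fourierL2 f ξ = 0 :=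
    haddξ.symm.trans ((mul_eq_zero.1 hφξ).resolve_right hne.2)
  exact hfξ (by linear_combination (hplus - hminus) / 2)

theorem HasGoodFSupportOverlap.reflTransGen {Λ : Type*} {ψ : Λ → L2R d}
    (hψ : HasGoodFSupportOverlap ψ) (l m : Λ) :
    Relation.ReflTransGen (fun l m => FrequenciesOverlap (ψ l) (ψ m)) l m := by
  obtain ⟨U, hU, hcover, hmeet⟩ := hψ
  let R : Set Λ := {k | Relation.ReflTransGen (fun l m => FrequenciesOverlap (ψ l) (ψ m)) l k}
  by_contra hm
  obtain ⟨ξ, -, hξ, hξ'⟩ := isPreconnected_univ (α := Rd d) (⋃ k ∈ R, U k) (⋃ k ∈ Rᶜ, U k)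
    (isOpen_biUnion fun k _ => (hU k).1) (isOpen_biUnion fun k _ => (hU k).1)
    (fun ξ _ => by
      obtain ⟨k, hk⟩ := Set.mem_iUnion.1 (hcover.symm ▸ Set.mem_univ ξ)
      exact (em (k ∈ R)).imp (Set.mem_biUnion · hk) (Set.mem_biUnion · hk))
    ((hU l).2.1.mono fun ξ hξ => ⟨Set.mem_univ ξ, Set.mem_biUnion .refl hξ⟩)
    ((hU m).2.1.mono fun ξ hξ => ⟨Set.mem_univ ξ, Set.mem_biUnion hm hξ⟩)
  obtain ⟨k, hk, hξk⟩ := Set.mem_iUnion₂.1 hξ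
  obtain ⟨k', hk', hξk'⟩ := Set.mem_iUnion₂.1 hξ'
  refine hk' (hk.tail fun hnot => hmeet k k' ⟨ξ, hξk, hξk'⟩ ?_)
  exact measure_mono_null (fun _ hη => not_not.2 hη.2) hnot

end Frames

end SignRetrieval

theorem theorem4p1_general {d : ℕ} {Λ : Type*} (ψ : Λ → SignRetrieval.L2R d)
    (hcomplete : ∀ g : SignRetrieval.L2R d, (∀ l, SignRetrieval.conv g (ψ l) = 0) → g = 0)
    (hoverlap : ∀ l m, Relation.ReflTransGen
      (fun l m => SignRetrieval.FrequenciesOverlap (ψ l) (ψ m)) l m)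
    (X : Λ → Set (SignRetrieval.Rd d))
    (hX : ∀ l, SignRetrieval.IsSignBlindSamplingSet (SignRetrieval.freqSupport (ψ l)) (X l))
    (f : SignRetrieval.L2R d) (hf : f ≠ 0 → ∀ᵐ ξ, SignRetrieval.fourierL2 f ξ ≠ 0)
    (h : SignRetrieval.L2R d)
    (hsamples : ∀ l, ∀ x ∈ X l,
      |SignRetrieval.conv f (ψ l) x| = |SignRetrieval.conv h (ψ l) x|) :
    h = f ∨ h = -f := by
  have hsign (l : Λ) : SignRetrieval.conv (h - f) (ψ l) = 0 ∨
      SignRetrieval.conv (h + f) (ψ l) = 0 := by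
    refine SignRetrieval.conv_eq_zero_or_conv_eq_zero (hX l) fun x hx => ?_
    rw [SignRetrieval.conv_sub_left, SignRetrieval.conv_add_left, Pi.sub_apply, Pi.add_apply]
    linear_combination -(sq_eq_sq_iff_abs_eq_abs _ _).2 (hsamples l x hx)
  rcases eq_or_ne f 0 with rfl | hf₀
  · simp only [sub_zero, add_zero, or_self] at hsign
    exact .inl (hcomplete h hsign)
  by_cases hplus : ∃ l, SignRetrieval.conv (h - f) (ψ l) = 0
  · obtain ⟨l, hl⟩ := hplus
    refine .inl (sub_eq_zero.1 (hcomplete _ fun m => ?_))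
    induction hoverlap l m with
    | refl => exact hl
    | tail _ hkm hk => exact (hsign _).resolve_right (hkm.conv_add_ne_zero (hf hf₀) hk)
  · exact .inr (eq_neg_of_add_eq_zero_left (hcomplete _ fun m =>
      (hsign m).resolve_left fun hm => hplus ⟨m, hm⟩))

theorem theorem4p1 {d : ℕ} {Λ : Type*} (ψ : Λ → SignRetrieval.L2R d)
    (hband : ∀ l, SignRetrieval.IsBandLimited (ψ l))
    (hframe : SignRetrieval.IsSemiDiscreteFrame ψ)
    (hoverlap : SignRetrieval.HasGoodFSupportOverlap ψ)
    (X : Λ → Set (SignRetrieval.Rd d))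
    (hX : ∀ l, SignRetrieval.IsSignBlindSamplingSet (SignRetrieval.freqSupport (ψ l)) (X l))
    (f : SignRetrieval.L2R d)
    (hf : ∃ α : ℝ, 0 < α ∧
      Integrable (fun x : SignRetrieval.Rd d => |f x| * Real.exp (α * ‖x‖)) volume)
    (h : SignRetrieval.L2R d)
    (hsamples : ∀ l, ∀ x ∈ X l,
      |SignRetrieval.conv f (ψ l) x| = |SignRetrieval.conv h (ψ l) x|) :
    h = f ∨ h = -f :=
  theorem4p1_general ψ hframe.eq_zero hoverlap.reflTransGen X hX f
    (SignRetrieval.fourierL2_ae_ne_zero hf) h hsamples
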